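/- Let $AF$ and $AP$ be countable sets (of atomic formulas and atomic programs). Programs $\alpha$ and formulas $\phi$ are given by $$\alpha ::= a \mid \alpha;\alpha \mid \alpha\cup\alpha \mid \alpha^{*} \mid \phi?, \qquad \phi ::= p \mid \bot \mid {\sim}\phi \mid \phi\land\phi \mid \phi\lor\phi \mid \phi\to\phi \mid [\alpha]\phi \mid \langle\alpha\rangle\phi \qquad (a\in AP,\ p\in AF),$$ with $\neg\phi := \phi\to\bot$, $\top := \neg\bot$ and $\phi\leftrightarrow\psi := (\phi\to\psi)\land(\psi\to\phi)$. A standard dynamic Odintsov–Wansing model is a tuple $\langle S,R,V^{+},V^{-}\rangle$ with $S\neq\emptyset$, $V^{+},V^{-}:AF\to 2^{S}$, and $R$ assigning to each program $\alpha$ a relation $R_\alpha\subseteq S\times S$, with relations $\models^{+},\models^{-}$ between states and formulas, such that: - $x\models^{\pm}p$ iff $x\in V^{\pm}(p)$; $x\not\models^{+}\bot$ and $x\models^{-}\bot$ for all $x$; - $x\models^{+}{\sim}\phi$ iff $x\models^{-}\phi$; $x\models^{-}{\sim}\phi$ iff $x\models^{+}\phi$; - $x\models^{+}\phi\land\psi$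 iff $x\models^{+}\phi$ and $x\models^{+}\psi$; $x\models^{-}\phi\land\psi$ iff $x\models^{-}\phi$ or $x\models^{-}\psi$; - $x\models^{+}\phi\lor\psi$ iff $x\models^{+}\phi$ or $x\models^{+}\psi$; $x\models^{-}\phi\lor\psi$ iff $x\models^{-}\phi$ and $x\models^{-}\psi$; - $x\models^{+}\phi\to\psi$ iff $x\not\models^{+}\phi$ or $x\models^{+}\psi$; $x\models^{-}\phi\to\psi$ iff $x\models^{+}\phi$ and $x\models^{-}\psi$; - $x\models^{+}[\alpha]\phi$ iff $y\models^{+}\phi$ for all $y$ with $R_\alpha xy$; $x\models^{-}[\alpha]\phi$ iff $y\models^{-}\phi$ for some $y$ with $R_\alpha xy$; - $x\models^{+}\langle\alpha\rangle\phi$ iff $y\models^{+}\phi$ for some $y$ with $R_\alpha xy$; $x\models^{-}\langle\alpha\rangle\phi$ iff $y\models^{-}\phi$ for all $y$ with $R_\alpha xy$; - $R_{\alpha;\beta}$ is the composition and $R_{\alpha\cup\beta}$ the union of $R_\alpha$ and $R_\beta$, $R_{\alpha^{*}}$ is the reflexive transitive closure of $R_\alpha$, and $R_{\phi?}=\{(x,x)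 : x\models^{+}\phi\}$. A formula $\phi$ is valid in $\mathbf{BPDL}$ if $x\models^{+}\phi$ for every state $x$ of every standard dynamic Odintsov–Wansing model. The Hilbert system $H(\mathbf{BPDL})$ has the rules Modus ponens and Necessitation (from $\phi$ infer $[\alpha]\phi$) and the following axiom schemata: 1. axiom schemata of classical propositional logic in $\bot,\to,\land,\lor$; 2. ${\sim}{\sim}\phi\leftrightarrow\phi$, ${\sim}(\phi\land\psi)\leftrightarrow({\sim}\phi\lor{\sim}\psi)$, ${\sim}(\phi\lor\psi)\leftrightarrow({\sim}\phi\land{\sim}\psi)$, ${\sim}(\phi\to\psi)\leftrightarrow(\phi\land{\sim}\psi)$, $\top\leftrightarrow{\sim}\bot$; 3. $[\alpha](\phi\to\psi)\to([\alpha]\phi\to[\alpha]\psi)$; 4. $\neg[\alpha]\phi\leftrightarrow\langle\alpha\rangle\neg\phi$, $\neg\langle\alpha\rangle\phi\leftrightarrow[\alpha]\neg\phi$, ${\sim}[\alpha]\phi\leftrightarrow\langle\alpha\rangle{\sim}\phi$, $[\alpha]\phi\leftrightarrow{\sim}\langle\alpha\rangle{\sim}\phi$, ${\sim}\langle\alpha\rangle\phi\leftrightarrow[\alpha]{\sim}\phi$,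 $\langle\alpha\rangle\phi\leftrightarrow{\sim}[\alpha]{\sim}\phi$; 5. $[\alpha\cup\beta]\phi\leftrightarrow([\alpha]\phi\land[\beta]\phi)$, $\langle\alpha\cup\beta\rangle\phi\leftrightarrow(\langle\alpha\rangle\phi\lor\langle\beta\rangle\phi)$; $[\alpha;\beta]\phi\leftrightarrow[\alpha][\beta]\phi$, $\langle\alpha;\beta\rangle\phi\leftrightarrow\langle\alpha\rangle\langle\beta\rangle\phi$; $[\psi?]\phi\leftrightarrow(\psi\to\phi)$, $\langle\psi?\rangle\phi\leftrightarrow(\psi\land\phi)$; $[\alpha^{*}]\phi\leftrightarrow(\phi\land[\alpha][\alpha^{*}]\phi)$, $\langle\alpha^{*}\rangle\phi\leftrightarrow(\phi\lor\langle\alpha\rangle\langle\alpha^{*}\rangle\phi)$; $(\phi\land[\alpha^{*}](\phi\to[\alpha]\phi))\to[\alpha^{*}]\phi$, $\langle\alpha^{*}\rangle\phi\to(\phi\lor\langle\alpha^{*}\rangle(\neg\phi\land\langle\alpha\rangle\phi))$. **Theorem.** For every formula $\phi$: $\phi$ is provable in $H(\mathbf{BPDL})$ if and only if $\phi$ is valid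 in $\mathbf{BPDL}$. -/

import Mathlib

universe u v w

namespace BPDL

mutual
/-- Formulas over atomic formulas `AF` and atomic programs `AP`. `neg` is the strong
negation `∼`; the classical negation `¬ φ` is the defined formula `φ → ⊥`. -/
inductive Form (AF : Type u) (AP : Type v) : Type (max u v)
  | atom : AF → Form AF AP
  | bot : Form AF AP
  | neg : Form AF AP → Form AF AP
  | conj : Form AF AP → Form AF AP → Form AF AP
  | disj : Form AF AP → Form AF AP → Form AF AP
  | imp : Form AF AP → Form AF AP → Form AF AP
  | box : Prog AF AP → Form AF AP → Form AF AP
  | dia : Prog AF AP → Form AF AP → Form AF AP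
/-- Programs: atomic programs, composition, choice, iteration and test. -/
inductive Prog (AF : Type u) (AP : Type v) : Type (max u v)
  | atom : AP → Prog AF AP
  | seq : Prog AF AP → Prog AF AP → Prog AF AP
  | choice : Prog AF AP → Prog AF AP → Prog AF AP
  | star : Prog AF AP → Prog AF AP
  | test : Form AF AP → Prog AF AP
end

/-- `¬ φ := φ → ⊥`. -/
def Form.cneg {AF : Type u} {AP : Type v} (φ : Form AF AP) : Form AF AP :=
  Form.imp φ Form.bot

/-- `⊤ := ¬ ⊥`. -/
def Form.top {AF : Type u} {AP : Type v} : Form AF AP := Form.cneg Form.bot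

/-- `φ ↔ ψ := (φ → ψ) ∧ (ψ → φ)`. -/
def Form.equiv {AF : Type u} {AP : Type v} (φ ψ : Form AF AP) : Form AF AP :=
  Form.conj (Form.imp φ ψ) (Form.imp ψ φ)

prefix:75 "∼ᶠ" => Form.neg
prefix:75 "¬ᶠ" => Form.cneg
infixr:70 " ∧ᶠ " => Form.conj
infixr:65 " ∨ᶠ " => Form.disj
infixr:60 " →ᶠ " => Form.imp
infix:55 " ↔ᶠ " => Form.equiv

/-- The data of a dynamic Odintsov–Wansing model with state set `S`: a relation on `S` for every
program and a pair of valuations. The conditions on the relations of complex programs, which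
refer to the satisfaction relation, are stated in `Structure.IsStandard`. -/
structure Structure (AF : Type u) (AP : Type v) (S : Type w) where
  nonempty : Nonempty S
  R : Prog AF AP → S → S → Prop
  Vpos : AF → Set S
  Vneg : AF → Set S

mutual
/-- Verification, `x ⊨⁺ φ`. -/
def Structure.Pos {AF : Type u} {AP : Type v} {S : Type w} (M : Structure AF AP S) :
    Form AF AP → S → Prop
  | .atom p, x => x ∈ M.Vpos p
  | .bot, _ => False
  | .neg φ, x => M.Neg φ x
  | .conj φ ψ, x => M.Pos φ x ∧ M.Pos ψ x
  | .disj φ ψ, x => M.Pos φ x ∨ M.Pos ψ x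
  | .imp φ ψ, x => ¬ M.Pos φ x ∨ M.Pos ψ x
  | .box α φ, x => ∀ y, M.R α x y → M.Pos φ y
  | .dia α φ, x => ∃ y, M.R α x y ∧ M.Pos φ y
termination_by structural φ => φ
/-- Falsification, `x ⊨⁻ φ`. -/
def Structure.Neg {AF : Type u} {AP : Type v} {S : Type w} (M : Structure AF AP S) :
    Form AF AP → S → Prop
  | .atom p, x => x ∈ M.Vneg p
  | .bot, _ => True
  | .neg φ, x => M.Pos φ x
  | .conj φ ψ, x => M.Neg φ x ∨ M.Neg ψ x
  | .disj φ ψ, x => M.Neg φ x ∧ M.Neg ψ x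
  | .imp φ ψ, x => M.Pos φ x ∧ M.Neg ψ x
  | .box α φ, x => ∃ y, M.R α x y ∧ M.Neg φ y
  | .dia α φ, x => ∀ y, M.R α x y → M.Neg φ y
termination_by structural φ => φ
end

/-- `M` is a standard dynamic Odintsov–Wansing model. -/
structure Structure.IsStandard {AF : Type u} {AP : Type v} {S : Type w}
    (M : Structure AF AP S) : Prop where
  seq : ∀ α β x y, M.R (.seq α β) x y ↔ ∃ z, M.R α x z ∧ M.R β z y
  choice : ∀ α β x y, M.R (.choice α β) x y ↔ M.R α x y ∨ M.R β x y
  star : ∀ α x y, M.R (.star α) x y ↔ Relation.ReflTransGen (M.R α) x y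
  test : ∀ φ x y, M.R (.test φ) x y ↔ x = y ∧ M.Pos φ x

/-- Validity in every standard dynamic Odintsov–Wansing model (with state set in `Type w`). -/
def Valid {AF : Type u} {AP : Type v} (φ : Form AF AP) : Prop :=
  ∀ (S : Type w) (M : Structure AF AP S), M.IsStandard → ∀ x : S, M.Pos φ x

open Form Prog in
/-- The axioms of the Hilbert system `H(BPDL)`. -/
inductive IsAxiom {AF : Type u} {AP : Type v} : Form AF AP → Prop
  -- classical propositional logic
  | imp_const (φ ψ) : IsAxiom (φ →ᶠ ψ →ᶠ φ)
  | imp_dist (φ ψ χ) : IsAxiom ((φ →ᶠ ψ →ᶠ χ) →ᶠ (φ →ᶠ ψ) →ᶠ φ →ᶠ χ)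
  | conj_left (φ ψ) : IsAxiom (φ ∧ᶠ ψ →ᶠ φ)
  | conj_right (φ ψ) : IsAxiom (φ ∧ᶠ ψ →ᶠ ψ)
  | conj_intro (φ ψ) : IsAxiom (φ →ᶠ ψ →ᶠ φ ∧ᶠ ψ)
  | disj_left (φ ψ) : IsAxiom (φ →ᶠ φ ∨ᶠ ψ)
  | disj_right (φ ψ) : IsAxiom (ψ →ᶠ φ ∨ᶠ ψ)
  | disj_elim (φ ψ χ) : IsAxiom ((φ →ᶠ χ) →ᶠ (ψ →ᶠ χ) →ᶠ φ ∨ᶠ ψ →ᶠ χ)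
  | bot_elim (φ) : IsAxiom (bot →ᶠ φ)
  | excluded_middle (φ) : IsAxiom (φ ∨ᶠ ¬ᶠφ)
  -- strong negation
  | neg_neg (φ) : IsAxiom (∼ᶠ(∼ᶠφ) ↔ᶠ φ)
  | neg_conj (φ ψ) : IsAxiom (∼ᶠ(φ ∧ᶠ ψ) ↔ᶠ ∼ᶠφ ∨ᶠ ∼ᶠψ)
  | neg_disj (φ ψ) : IsAxiom (∼ᶠ(φ ∨ᶠ ψ) ↔ᶠ ∼ᶠφ ∧ᶠ ∼ᶠψ)
  | neg_imp (φ ψ) : IsAxiom (∼ᶠ(φ →ᶠ ψ) ↔ᶠ φ ∧ᶠ ∼ᶠψ)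
  | top_neg_bot : IsAxiom (top ↔ᶠ ∼ᶠbot)
  -- the modal axiom K
  | box_dist (α φ ψ) : IsAxiom (box α (φ →ᶠ ψ) →ᶠ box α φ →ᶠ box α ψ)
  -- modal interaction principles
  | cneg_box (α φ) : IsAxiom (¬ᶠ(box α φ) ↔ᶠ dia α (¬ᶠφ))
  | cneg_dia (α φ) : IsAxiom (¬ᶠ(dia α φ) ↔ᶠ box α (¬ᶠφ))
  | neg_box (α φ) : IsAxiom (∼ᶠ(box α φ) ↔ᶠ dia α (∼ᶠφ))
  | box_dual (α φ) : IsAxiom (box α φ ↔ᶠ ∼ᶠ(dia α (∼ᶠφ)))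
  | neg_dia (α φ) : IsAxiom (∼ᶠ(dia α φ) ↔ᶠ box α (∼ᶠφ))
  | dia_dual (α φ) : IsAxiom (dia α φ ↔ᶠ ∼ᶠ(box α (∼ᶠφ)))
  -- program axioms
  | box_choice (α β φ) : IsAxiom (box (choice α β) φ ↔ᶠ box α φ ∧ᶠ box β φ)
  | dia_choice (α β φ) : IsAxiom (dia (choice α β) φ ↔ᶠ dia α φ ∨ᶠ dia β φ)
  | box_seq (α β φ) : IsAxiom (box (seq α β) φ ↔ᶠ box α (box β φ))
  | dia_seq (α β φ) : IsAxiom (dia (seq α β) φ ↔ᶠ dia α (dia β φ))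
  | box_test (ψ φ) : IsAxiom (box (test ψ) φ ↔ᶠ (ψ →ᶠ φ))
  | dia_test (ψ φ) : IsAxiom (dia (test ψ) φ ↔ᶠ ψ ∧ᶠ φ)
  | box_star (α φ) : IsAxiom (box (star α) φ ↔ᶠ φ ∧ᶠ box α (box (star α) φ))
  | dia_star (α φ) : IsAxiom (dia (star α) φ ↔ᶠ φ ∨ᶠ dia α (dia (star α) φ))
  | box_ind (α φ) : IsAxiom (φ ∧ᶠ box (star α) (φ →ᶠ box α φ) →ᶠ box (star α) φ)
  | dia_ind (α φ) : IsAxiom (dia (star α) φ →ᶠ φ ∨ᶠ dia (star α) (¬ᶠφ ∧ᶠ dia α φ))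

/-- Provability in `H(BPDL)`: closure of the axioms under Modus ponens and Necessitation. -/
inductive Provable {AF : Type u} {AP : Type v} : Form AF AP → Prop
  | ax {φ} : IsAxiom φ → Provable φ
  | mp {φ ψ} : Provable (φ →ᶠ ψ) → Provable φ → Provable ψ
  | nec {φ} (α : Prog AF AP) : Provable φ → Provable (Form.box α φ)

end BPDL

/-!
Soundness is checked axiom by axiom. For completeness, let `φ` be unprovable. Some maximal
consistent set omits `φ`, and the model refuting `φ` is a filtration of the canonical frame of
all maximal consistent sets, in which `y` is an `α`-successor of `x` when `[α]ψ ∈ x` implies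
`ψ ∈ y`. That frame itself is not standard: the canonical relation of `α*` may exceed the
reflexive transitive closure of that of `α`.

Strong negation is not a congruence, so falsification is treated on a par with verification: the
truth lemma says at once that `ψ ∈ x` iff the class of `x` verifies `ψ`, and `∼ψ ∈ x` iff it
falsifies `ψ`. The two modalities are both reduced to boxes by the classical duality axioms.

The filtration identifies maximal consistent sets that agree on a finite list of formulas
(`Form.relevant`), which plays the role of the Fischer–Ladner closure and is defined by structural
recursion, together with the formulas `Prog.boxRelevant α ψ` needed to reason about `[α]ψ`.
In the quotient, atomic programs get the smallest relation containing the image of the canonical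
one, and complex programs their standard interpretation. Since the list is finite, every set of
quotient states is defined by a formula (`exists_formula_of_invariant`). Hence the image of the
canonical relation of *every* program is contained in its standard interpretation: if `χ` defines
the states that are `α`-reachable from the class of `x`, then the axioms for `α` give `[α]χ ∈ x`;
for iterations this is the induction axiom. Conversely, along standard transitions `[α]ψ` still
propagates `ψ`. These two facts and the truth lemma depend on each other through tests, and are
proved by one mutual induction (`mem_iff_of_relevant`, `rel_of_boxRelevant`).
-/

namespace BPDL

variable {AF : Type u} {AP : Type v}

/-! ### Soundness -/

theorem IsAxiom.pos {S : Type w} {M : Structure AF AP S} (hM : M.IsStandard)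
    {φ : Form AF AP} (h : IsAxiom φ) (x : S) : M.Pos φ x := by
  cases h with
  | box_star α φ =>
    simp only [Form.equiv, Structure.Pos, hM.star, ← imp_iff_not_or]
    refine ⟨fun h => ⟨h x .refl, fun y hy z hz => h z (.head hy hz)⟩, fun h y hy => ?_⟩
    obtain rfl | ⟨z, hz, hzy⟩ := hy.cases_head
    exacts [h.1, h.2 z hz y hzy]
  | dia_star α φ =>
    simp only [Form.equiv, Structure.Pos, hM.star, ← imp_iff_not_or]
    constructor
    · rintro ⟨y, hy, hφ⟩
      obtain rfl | ⟨z, hz, hzy⟩ := hy.cases_head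
      exacts [.inl hφ, .inr ⟨z, hz, y, hzy, hφ⟩]
    · rintro (h | ⟨z, hz, y, hy, hφ⟩)
      exacts [⟨x, .refl, h⟩, ⟨y, .head hz hy, hφ⟩]
  | box_ind α φ =>
    simp only [Structure.Pos, hM.star, ← imp_iff_not_or]
    rintro ⟨h0, h⟩ y hy
    induction hy with
    | refl => exact h0
    | tail hab hbc ih => exact h _ hab ih _ hbc
  | dia_ind α φ =>
    simp only [Form.cneg, Structure.Pos, hM.star, ← imp_iff_not_or, imp_false]
    rintro ⟨y, hy, hφ⟩
    by_contra hc
    push Not at hc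
    -- `φ` fails at `x`, and its failure is preserved along `α`-steps.
    have key : ∀ z, Relation.ReflTransGen (M.R α) x z → ¬ M.Pos φ z := by
      intro z hz
      induction hz with
      | refl => exact hc.1
      | tail hab hbc ih => exact hc.2 _ hab ih _ hbc
    exact key y hy hφ
  | box_seq α β φ =>
    simp only [Form.equiv, Structure.Pos, hM.seq]
    grind
  | dia_seq α β φ =>
    simp only [Form.equiv, Structure.Pos, hM.seq]
    grind
  | box_choice α β φ =>
    simp only [Form.equiv, Structure.Pos, hM.choice]
    grind
  | dia_choice α β φ =>
    simp only [Form.equiv, Structure.Pos, hM.choice]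
    grind
  | box_test α φ =>
    simp only [Form.equiv, Structure.Pos, hM.test]
    grind
  | dia_test α φ =>
    simp only [Form.equiv, Structure.Pos, hM.test]
    grind
  | _ =>
    simp only [Form.equiv, Form.cneg, Form.top, Structure.Pos, Structure.Neg]
    grind

theorem Provable.pos {S : Type w} {M : Structure AF AP S} (hM : M.IsStandard)
    {φ : Form AF AP} (h : Provable φ) : ∀ x : S, M.Pos φ x := by
  induction h with
  | ax h => exact h.pos hM
  | mp _ _ ih₁ ih₂ => exact fun x => (ih₁ x).resolve_left (not_not_intro (ih₂ x))
  | nec α _ ih => exact fun x y _ => ih y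

/-! ### Derivability from hypotheses -/

/-- Derivability of a formula from hypotheses in `Γ`, using theorems of `H(BPDL)` and Modus ponens
only; Necessitation is not applied below a hypothesis. -/
inductive Deriv (Γ : Set (Form AF AP)) : Form AF AP → Prop
  | thm {φ} : Provable φ → Deriv Γ φ
  | hyp {φ} : φ ∈ Γ → Deriv Γ φ
  | mp {φ ψ} : Deriv Γ (φ →ᶠ ψ) → Deriv Γ φ → Deriv Γ ψ

theorem Deriv.ax {Γ : Set (Form AF AP)} {φ : Form AF AP} (h : IsAxiom φ) : Deriv Γ φ :=
  .thm (.ax h)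

theorem Provable.imp_self (φ : Form AF AP) : Provable (φ →ᶠ φ) :=
  .mp (.mp (.ax (.imp_dist φ (φ →ᶠ φ) φ)) (.ax (.imp_const _ _))) (.ax (.imp_const _ _))

theorem Deriv.deduction {Γ : Set (Form AF AP)} {φ ψ : Form AF AP}
    (h : Deriv (insert φ Γ) ψ) : Deriv Γ (φ →ᶠ ψ) := by
  induction h with
  | thm h => exact .mp (.ax (.imp_const _ _)) (.thm h)
  | hyp h =>
    obtain rfl | h := h
    · exact .thm (.imp_self _)
    · exact .mp (.ax (.imp_const _ _)) (.hyp h)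
  | mp _ _ ih₁ ih₂ => exact .mp (.mp (.ax (.imp_dist _ _ _)) ih₁) ih₂

theorem Deriv.mono {Γ Δ : Set (Form AF AP)} (hΓ : Γ ⊆ Δ) {φ : Form AF AP} (h : Deriv Γ φ) :
    Deriv Δ φ := by
  induction h with
  | thm h => exact .thm h
  | hyp h => exact .hyp (hΓ h)
  | mp _ _ ih₁ ih₂ => exact .mp ih₁ ih₂

theorem Deriv.provable {φ : Form AF AP} (h : Deriv ∅ φ) : Provable φ := by
  induction h with
  | thm h => exact h
  | hyp h => exact h.elim
  | mp _ _ ih₁ ih₂ => exact .mp ih₁ ih₂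

theorem Deriv.exists_of_sUnion {c : Set (Set (Form AF AP))} (hc : IsChain (· ⊆ ·) c)
    (hne : c.Nonempty) {φ : Form AF AP} (h : Deriv (⋃₀ c) φ) : ∃ Γ ∈ c, Deriv Γ φ := by
  induction h with
  | thm h => exact hne.imp fun Γ hΓ => ⟨hΓ, .thm h⟩
  | hyp h =>
    obtain ⟨Γ, hΓ, h⟩ := h
    exact ⟨Γ, hΓ, .hyp h⟩
  | mp _ _ ih₁ ih₂ =>
    obtain ⟨Γ, hΓ, h₁⟩ := ih₁
    obtain ⟨Δ, hΔ, h₂⟩ := ih₂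
    obtain h | h := hc.total hΓ hΔ
    · exact ⟨Δ, hΔ, .mp (h₁.mono h) h₂⟩
    · exact ⟨Γ, hΓ, .mp h₁ (h₂.mono h)⟩

/-! ### Maximal consistent sets -/

/-- Maximal consistent sets of formulas; maximality is stated for the classical negation. -/
structure MCS (AF : Type u) (AP : Type v) where
  carrier : Set (Form AF AP)
  consistent : ¬ Deriv carrier .bot
  complete : ∀ φ, φ ∈ carrier ∨ ¬ᶠφ ∈ carrier

instance : Membership (Form AF AP) (MCS AF AP) := ⟨fun x φ => φ ∈ x.carrier⟩

/-- Lindenbaum's lemma. -/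
theorem exists_MCS_of_not_deriv {Γ : Set (Form AF AP)} {φ : Form AF AP} (h : ¬ Deriv Γ φ) :
    ∃ x : MCS AF AP, (∀ ψ ∈ Γ, ψ ∈ x) ∧ φ ∉ x := by
  obtain ⟨Δ, hΓΔ, hΔ⟩ := zorn_subset_nonempty {Δ : Set (Form AF AP) | ¬ Deriv Δ φ}
    (fun c hc hchain hne => ⟨⋃₀ c, fun hd => by
      obtain ⟨Δ, hΔ, hd⟩ := hd.exists_of_sUnion hchain hne
      exact hc hΔ hd, fun _ => Set.subset_sUnion_of_mem⟩) Γ h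
  have hφ : ¬ Deriv Δ φ := hΔ.prop
  have key : ∀ ψ, ψ ∉ Δ → Deriv Δ (ψ →ᶠ φ) := fun ψ hψ => by
    by_contra hd
    exact hψ (hΔ.le_of_ge (y := insert ψ Δ) (fun h' => hd h'.deduction) (Set.subset_insert _ _)
      (Set.mem_insert _ _))
  refine ⟨⟨Δ, fun hb => hφ (.mp (.ax (.bot_elim φ)) hb), fun ψ => ?_⟩,
    fun ψ hψ => hΓΔ hψ, fun hm => hφ (.hyp hm)⟩
  by_contra! hc
  exact hφ (.mp (.mp (.mp (.ax (.disj_elim _ _ _)) (key _ hc.1)) (key _ hc.2))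
    (.ax (.excluded_middle ψ)))

namespace MCS

variable {x y : MCS AF AP} {φ ψ : Form AF AP}

theorem mem_of_deriv (h : Deriv x.carrier φ) : φ ∈ x :=
  (x.complete φ).resolve_right fun hn => x.consistent (.mp (.hyp hn) h)

theorem mp (h : φ →ᶠ ψ ∈ x) (hφ : φ ∈ x) : ψ ∈ x :=
  mem_of_deriv (.mp (.hyp h) (.hyp hφ))

theorem mem_of_isAxiom (h : IsAxiom φ) : φ ∈ x := mem_of_deriv (.ax h)

@[simp] theorem not_mem_bot : (Form.bot : Form AF AP) ∉ x := fun h => x.consistent (.hyp h)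

@[simp] theorem mem_imp : φ →ᶠ ψ ∈ x ↔ (φ ∈ x → ψ ∈ x) := by
  refine ⟨mp, fun h => ?_⟩
  obtain hφ | hφ := x.complete φ
  · exact mp (mem_of_isAxiom (.imp_const _ _)) (h hφ)
  · refine mem_of_deriv (Deriv.deduction (.mp (.ax (.bot_elim _)) (.mp (φ := φ) ?_ ?_)))
    · exact .hyp (Set.mem_insert_of_mem _ hφ)
    · exact .hyp (Set.mem_insert _ _)

@[simp] theorem mem_conj : φ ∧ᶠ ψ ∈ x ↔ φ ∈ x ∧ ψ ∈ x :=
  ⟨fun h => ⟨mp (mem_of_isAxiom (.conj_left _ _)) h, mp (mem_of_isAxiom (.conj_right _ _)) h⟩,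
    fun h => mp (mp (mem_of_isAxiom (.conj_intro _ _)) h.1) h.2⟩

@[simp] theorem mem_cneg : ¬ᶠφ ∈ x ↔ φ ∉ x := by simp [Form.cneg]

@[simp] theorem mem_disj : φ ∨ᶠ ψ ∈ x ↔ φ ∈ x ∨ ψ ∈ x := by
  refine ⟨fun h => ?_, fun h => h.elim (mp (mem_of_isAxiom (.disj_left _ _)))
    (mp (mem_of_isAxiom (.disj_right _ _)))⟩
  by_contra! hc
  have := mp (mp (mem_of_isAxiom (x := x) (.disj_elim φ ψ .bot)) (mem_cneg.2 hc.1))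
    (mem_cneg.2 hc.2)
  exact not_mem_bot (mp this h)

theorem mem_iff_of_isAxiom (h : IsAxiom (φ ↔ᶠ ψ)) : φ ∈ x ↔ ψ ∈ x := by
  have := mem_of_isAxiom (x := x) h
  simp only [Form.equiv, mem_conj, mem_imp] at this
  exact ⟨this.1, this.2⟩

/-- The canonical relation of a program. -/
def Rel (α : Prog AF AP) (x y : MCS AF AP) : Prop := ∀ φ, Form.box α φ ∈ x → φ ∈ y

/-- The existence lemma: maximal consistent sets have enough canonical successors. -/
theorem mem_box {α : Prog AF AP} : Form.box α φ ∈ x ↔ ∀ y, Rel α x y → φ ∈ y := by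
  refine ⟨fun h y hy => hy φ h, fun h => ?_⟩
  by_contra hx
  have key : ∀ ψ, Deriv {ψ | Form.box α ψ ∈ x} ψ → Form.box α ψ ∈ x := by
    intro ψ hψ
    induction hψ with
    | thm h => exact mem_of_deriv (.thm (.nec α h))
    | hyp h => exact h
    | mp _ _ ih₁ ih₂ => exact mp (mp (mem_of_isAxiom (.box_dist _ _ _)) ih₁) ih₂
  obtain ⟨y, hy, hφ⟩ := exists_MCS_of_not_deriv (mt (key φ) hx)
  exact hφ (h y hy)

theorem mem_dia_iff_box_cneg {α : Prog AF AP} :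
    Form.dia α φ ∈ x ↔ Form.box α (¬ᶠφ) ∉ x := by
  rw [← mem_iff_of_isAxiom (.cneg_dia α φ), mem_cneg, not_not]

theorem mem_dia {α : Prog AF AP} : Form.dia α φ ∈ x ↔ ∃ y, Rel α x y ∧ φ ∈ y := by
  simp [mem_dia_iff_box_cneg, mem_box]

end MCS

/-- A property of maximal consistent sets which depends only on the membership of finitely many
formulas is defined by a formula. -/
theorem exists_formula_of_invariant (L : List (Form AF AP)) (P : MCS AF AP → Prop)
    (hP : ∀ x y : MCS AF AP, (∀ ψ ∈ L, ψ ∈ x ↔ ψ ∈ y) → P x → P y) :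
    ∃ χ : Form AF AP, ∀ x : MCS AF AP, χ ∈ x ↔ P x := by
  induction L generalizing P with
  | nil =>
    -- Without formulas to depend on, `P` is constant.
    by_cases h : ∃ x, P x
    · obtain ⟨x, hx⟩ := h
      exact ⟨¬ᶠ.bot, fun y => by simp [hP x y (by simp) hx]⟩
    · exact ⟨.bot, fun y => by simpa using fun hy => h ⟨y, hy⟩⟩
  | cons ψ L ih =>
    -- Split `P` according to the membership of `ψ`, forgetting `ψ` in both parts.
    obtain ⟨χ₁, h₁⟩ := ih (fun x => ∃ y, (∀ θ ∈ L, θ ∈ x ↔ θ ∈ y) ∧ ψ ∈ y ∧ P y)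
      fun x x' hx ⟨y, hy, h⟩ => ⟨y, fun θ hθ => (hx θ hθ).symm.trans (hy θ hθ), h⟩
    obtain ⟨χ₀, h₀⟩ := ih (fun x => ∃ y, (∀ θ ∈ L, θ ∈ x ↔ θ ∈ y) ∧ ψ ∉ y ∧ P y)
      fun x x' hx ⟨y, hy, h⟩ => ⟨y, fun θ hθ => (hx θ hθ).symm.trans (hy θ hθ), h⟩
    refine ⟨(ψ ∧ᶠ χ₁) ∨ᶠ (¬ᶠψ ∧ᶠ χ₀), fun x => ?_⟩
    simp only [MCS.mem_disj, MCS.mem_conj, MCS.mem_cneg, h₁, h₀]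
    constructor
    · rintro (⟨hx, y, hy, hψ, h⟩ | ⟨hx, y, hy, hψ, h⟩) <;>
      · refine hP y x ?_ h
        simp only [List.mem_cons, forall_eq_or_imp, hx, hψ, true_and]
        exact fun θ hθ => (hy θ hθ).symm
    · intro h
      by_cases hx : ψ ∈ x
      · exact .inl ⟨hx, x, fun _ _ => Iff.rfl, hx, h⟩
      · exact .inr ⟨hx, x, fun _ _ => Iff.rfl, hx, h⟩

/-! ### Standard models from atomic data -/

section Standard

variable {S : Type w} (V W : AF → Set S) (r : AP → S → S → Prop)

mutual
/-- Verification in the standard model given by valuations `V`, `W` and by relations `r` for the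
atomic programs. -/
def stdPos : Form AF AP → S → Prop
  | .atom p, x => x ∈ V p
  | .bot, _ => False
  | .neg φ, x => stdNeg φ x
  | .conj φ ψ, x => stdPos φ x ∧ stdPos ψ x
  | .disj φ ψ, x => stdPos φ x ∨ stdPos ψ x
  | .imp φ ψ, x => ¬ stdPos φ x ∨ stdPos ψ x
  | .box α φ, x => ∀ y, stdRel α x y → stdPos φ y
  | .dia α φ, x => ∃ y, stdRel α x y ∧ stdPos φ y
termination_by structural φ => φ
/-- Falsification in the standard model given by atomic data. -/
def stdNeg : Form AF AP → S → Prop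
  | .atom p, x => x ∈ W p
  | .bot, _ => True
  | .neg φ, x => stdPos φ x
  | .conj φ ψ, x => stdNeg φ x ∨ stdNeg ψ x
  | .disj φ ψ, x => stdNeg φ x ∧ stdNeg ψ x
  | .imp φ ψ, x => stdPos φ x ∧ stdNeg ψ x
  | .box α φ, x => ∃ y, stdRel α x y ∧ stdNeg φ y
  | .dia α φ, x => ∀ y, stdRel α x y → stdNeg φ y
termination_by structural φ => φ
/-- Standard interpretation of programs, given atomic data. -/
def stdRel : Prog AF AP → S → S → Prop
  | .atom a, x, y => r a x y
  | .seq α β, x, y => ∃ z, stdRel α x z ∧ stdRel β z y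
  | .choice α β, x, y => stdRel α x y ∨ stdRel β x y
  | .star α, x, y => Relation.ReflTransGen (stdRel α) x y
  | .test φ, x, y => x = y ∧ stdPos φ x
termination_by structural α => α
end

/-- The standard model given by valuations and by relations for the atomic programs. -/
def stdModel [Nonempty S] : Structure AF AP S where
  nonempty := inferInstance
  R := stdRel V W r
  Vpos := V
  Vneg := W

theorem stdModel_pos_neg [Nonempty S] : ∀ φ : Form AF AP,
    (stdModel V W r).Pos φ = stdPos V W r φ ∧ (stdModel V W r).Neg φ = stdNeg V W r φ
  | .atom p => ⟨rfl, rfl⟩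
  | .bot => ⟨rfl, rfl⟩
  | .neg φ => (stdModel_pos_neg φ).symm
  | .conj φ ψ | .disj φ ψ | .imp φ ψ => by
    obtain ⟨h₁, h₂⟩ := stdModel_pos_neg φ
    obtain ⟨h₃, h₄⟩ := stdModel_pos_neg ψ
    constructor <;> funext x <;> simp only [Structure.Pos, Structure.Neg, stdPos, stdNeg, *]
  | .box α φ | .dia α φ => by
    obtain ⟨h₁, h₂⟩ := stdModel_pos_neg φ
    constructor <;> funext x <;> simp only [Structure.Pos, Structure.Neg, stdPos, stdNeg, *] <;> rfl

theorem stdModel_isStandard [Nonempty S] : (stdModel V W r).IsStandard where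
  seq _ _ _ _ := Iff.rfl
  choice _ _ _ _ := Iff.rfl
  star _ _ _ := Iff.rfl
  test φ x y := by rw [(stdModel_pos_neg V W r φ).1]; rfl

end Standard

/-! ### Filtration -/

mutual
/-- The formulas through which to filtrate in order to evaluate `φ` and `∼φ`. Diamonds are treated
as `¬[α]¬`, whence the negations. -/
def Form.relevant : Form AF AP → List (Form AF AP)
  | .atom p => [.atom p, ∼ᶠ(.atom p)]
  | .bot => []
  | .neg φ => φ.relevant
  | .conj φ ψ => φ.relevant ++ ψ.relevant
  | .disj φ ψ => φ.relevant ++ ψ.relevant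
  | .imp φ ψ => φ.relevant ++ ψ.relevant
  | .box α φ => α.boxRelevant φ ++ α.boxRelevant (¬ᶠ∼ᶠφ) ++ φ.relevant
  | .dia α φ => α.boxRelevant (¬ᶠφ) ++ α.boxRelevant (∼ᶠφ) ++ φ.relevant
termination_by structural φ => φ
/-- The formulas through which to filtrate in order that `[α]ψ` propagates `ψ` along `α`. -/
def Prog.boxRelevant : Prog AF AP → Form AF AP → List (Form AF AP)
  | .atom a, ψ => [.box (.atom a) ψ, ψ]
  | .seq α β, ψ => α.boxRelevant (.box β ψ) ++ β.boxRelevant ψ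
  | .choice α β, ψ => α.boxRelevant ψ ++ β.boxRelevant ψ
  | .star α, ψ => [.box (.star α) ψ, ψ] ++ α.boxRelevant (.box (.star α) ψ)
  | .test φ, ψ => [ψ] ++ φ.relevant
termination_by structural α => α
end

/-- `π` presents `T` as the quotient of the maximal consistent sets by agreement on `L`. -/
structure IsFiltration {T : Type w} (L : List (Form AF AP)) (π : MCS AF AP → T) : Prop where
  surjective : Function.Surjective π
  eq_iff : ∀ x y, π x = π y ↔ ∀ ψ ∈ L, ψ ∈ x ↔ ψ ∈ y

/-- Truth vectors on `L` form a quotient in any universe. -/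
theorem exists_isFiltration (L : List (Form AF AP)) :
    ∃ (T : Type w) (π : MCS AF AP → T), IsFiltration L π := by
  let f : MCS AF AP → Fin L.length → Prop := fun x i => L[i] ∈ x
  refine ⟨ULift (Set.range f), fun x => ⟨⟨f x, x, rfl⟩⟩, ?_, fun x y => ?_⟩
  · rintro ⟨⟨_, x, rfl⟩⟩
    exact ⟨x, rfl⟩
  · simp [ULift.ext_iff, f, funext_iff, List.forall_mem_iff_forall_getElem, Fin.forall_iff]

section Filtration

variable {T : Type w} (π : MCS AF AP → T)

/-- The states of the filtration having a representative that contains `φ`. -/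
def classesOf (φ : Form AF AP) : Set T := {t | ∃ x, π x = t ∧ φ ∈ x}

/-- The image of the canonical relation of an atomic program. -/
def filtAtom (a : AP) (s t : T) : Prop := ∃ x y, π x = s ∧ π y = t ∧ MCS.Rel (.atom a) x y

/-- Verification in the filtration. -/
abbrev filtPos : Form AF AP → T → Prop :=
  stdPos (fun p => classesOf π (.atom p)) (fun p => classesOf π (∼ᶠ(.atom p))) (filtAtom π)

/-- Falsification in the filtration. -/
abbrev filtNeg : Form AF AP → T → Prop :=
  stdNeg (fun p => classesOf π (.atom p)) (fun p => classesOf π (∼ᶠ(.atom p))) (filtAtom π)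

/-- The relation of a program in the filtration. -/
abbrev filtRel : Prog AF AP → T → T → Prop :=
  stdRel (fun p => classesOf π (.atom p)) (fun p => classesOf π (∼ᶠ(.atom p))) (filtAtom π)

variable {π} {L : List (Form AF AP)}

theorem IsFiltration.exists_formula (hπ : IsFiltration L π) (A : T → Prop) :
    ∃ χ : Form AF AP, ∀ x, χ ∈ x ↔ A (π x) :=
  exists_formula_of_invariant L _ fun x y h => by rw [(hπ.eq_iff x y).2 h]; exact id

/-- A canonical transition descends to the filtration as soon as `[α]χ ∈ x` for a formula `χ`
defining the `α`-successors of the class of `x`. -/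
theorem IsFiltration.filtRel_of_rel (hπ : IsFiltration L π) {α : Prog AF AP} {x y : MCS AF AP}
    (h : ∀ χ : Form AF AP, (∀ z, χ ∈ z ↔ filtRel π α (π x) (π z)) → Form.box α χ ∈ x)
    (hxy : MCS.Rel α x y) : filtRel π α (π x) (π y) := by
  obtain ⟨χ, hχ⟩ := hπ.exists_formula (filtRel π α (π x))
  exact (hχ y).1 (hxy χ (h χ hχ))

open MCS

mutual
/-- The truth lemma, for verification and falsification. -/
theorem mem_iff_of_relevant (hπ : IsFiltration L π) : ∀ φ : Form AF AP, φ.relevant ⊆ L →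
    ∀ x, (φ ∈ x ↔ filtPos π φ (π x)) ∧ (∼ᶠφ ∈ x ↔ filtNeg π φ (π x))
  | .atom p, hL, x => by
    simp only [Form.relevant, List.cons_subset] at hL
    refine ⟨⟨fun h => ⟨x, rfl, h⟩, ?_⟩, ⟨fun h => ⟨x, rfl, h⟩, ?_⟩⟩ <;> rintro ⟨y, hy, h⟩
    · exact ((hπ.eq_iff y x).1 hy _ hL.1).1 h
    · exact ((hπ.eq_iff y x).1 hy _ hL.2.1).1 h
  | .bot, _, x => by
    simp [stdPos, stdNeg, ← mem_iff_of_isAxiom .top_neg_bot, Form.top]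
  | .neg φ, hL, x => by
    have ih := mem_iff_of_relevant hπ φ hL x
    exact ⟨ih.2, (mem_iff_of_isAxiom (.neg_neg φ)).trans ih.1⟩
  | .conj φ ψ, hL, x => by
    simp only [Form.relevant, List.append_subset] at hL
    have ih₁ := mem_iff_of_relevant hπ φ hL.1 x
    have ih₂ := mem_iff_of_relevant hπ ψ hL.2 x
    simp [stdPos, stdNeg, mem_iff_of_isAxiom (.neg_conj φ ψ), ih₁, ih₂]
  | .disj φ ψ, hL, x => by
    simp only [Form.relevant, List.append_subset] at hL
    have ih₁ := mem_iff_of_relevant hπ φ hL.1 x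
    have ih₂ := mem_iff_of_relevant hπ ψ hL.2 x
    simp [stdPos, stdNeg, mem_iff_of_isAxiom (.neg_disj φ ψ), ih₁, ih₂]
  | .imp φ ψ, hL, x => by
    simp only [Form.relevant, List.append_subset] at hL
    have ih₁ := mem_iff_of_relevant hπ φ hL.1 x
    have ih₂ := mem_iff_of_relevant hπ ψ hL.2 x
    simp [stdPos, stdNeg, mem_iff_of_isAxiom (.neg_imp φ ψ), ih₁, ih₂, imp_iff_not_or]
  | .box α φ, hL, x => by
    simp only [Form.relevant, List.append_subset] at hL
    have ih := mem_iff_of_relevant hπ φ hL.2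
    have h₁ := rel_of_boxRelevant hπ α φ hL.1.1
    have h₂ := rel_of_boxRelevant hπ α _ hL.1.2
    rw [mem_iff_of_isAxiom (.neg_box α φ)]
    simp only [stdPos, stdNeg, hπ.surjective.forall, hπ.surjective.exists, ← ih]
    refine ⟨⟨fun h y hy => h₁.2 x y hy h, fun h => mem_box.2 fun y hy => h y (h₁.1 x y hy)⟩,
      fun h => ?_, ?_⟩
    · obtain ⟨y, hy, h⟩ := mem_dia.1 h
      exact ⟨y, h₁.1 x y hy, h⟩
    · rintro ⟨y, hy, h⟩
      exact mem_dia_iff_box_cneg.2 fun hb => mem_cneg.1 (h₂.2 x y hy hb) h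
  | .dia α φ, hL, x => by
    simp only [Form.relevant, List.append_subset] at hL
    have ih := mem_iff_of_relevant hπ φ hL.2
    have h₁ := rel_of_boxRelevant hπ α _ hL.1.1
    have h₂ := rel_of_boxRelevant hπ α _ hL.1.2
    rw [mem_iff_of_isAxiom (.neg_dia α φ)]
    simp only [stdPos, stdNeg, hπ.surjective.forall, hπ.surjective.exists, ← ih]
    refine ⟨⟨fun h => ?_, ?_⟩,
      fun h y hy => h₂.2 x y hy h, fun h => mem_box.2 fun y hy => h y (h₁.1 x y hy)⟩
    · obtain ⟨y, hy, h⟩ := mem_dia.1 h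
      exact ⟨y, h₁.1 x y hy, h⟩
    · rintro ⟨y, hy, h⟩
      exact mem_dia_iff_box_cneg.2 fun hb => mem_cneg.1 (h₁.2 x y hy hb) h
termination_by structural φ => φ
/-- Canonical transitions descend to the filtration, and boxed formulas propagate along the
transitions of the filtration. -/
theorem rel_of_boxRelevant (hπ : IsFiltration L π) : ∀ (α : Prog AF AP) (ψ : Form AF AP),
    α.boxRelevant ψ ⊆ L →
    (∀ x y, Rel α x y → filtRel π α (π x) (π y)) ∧
      ∀ x y, filtRel π α (π x) (π y) → Form.box α ψ ∈ x → ψ ∈ y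
  | .atom a, ψ, hL => by
    simp only [Prog.boxRelevant, List.cons_subset] at hL
    refine ⟨fun x y h => ⟨x, y, rfl, rfl, h⟩, ?_⟩
    rintro x y ⟨x', y', hx, hy, h⟩ hb
    exact ((hπ.eq_iff y' y).1 hy _ hL.2.1).1 (h ψ (((hπ.eq_iff x' x).1 hx _ hL.1).2 hb))
  | .seq α β, ψ, hL => by
    simp only [Prog.boxRelevant, List.append_subset] at hL
    have h₁ := rel_of_boxRelevant hπ α _ hL.1
    have h₂ := rel_of_boxRelevant hπ β _ hL.2
    refine ⟨fun x y => hπ.filtRel_of_rel fun χ hχ => ?_, fun x y h hb => ?_⟩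
    · rw [mem_iff_of_isAxiom (.box_seq α β χ)]
      exact mem_box.2 fun z hz => mem_box.2 fun t ht =>
        (hχ t).2 ⟨π z, h₁.1 x z hz, h₂.1 z t ht⟩
    · rw [mem_iff_of_isAxiom (.box_seq α β ψ)] at hb
      obtain ⟨t, hxt, hty⟩ := h
      obtain ⟨z, rfl⟩ := hπ.surjective t
      exact h₂.2 z y hty (h₁.2 x z hxt hb)
  | .choice α β, ψ, hL => by
    simp only [Prog.boxRelevant, List.append_subset] at hL
    have h₁ := rel_of_boxRelevant hπ α _ hL.1
    have h₂ := rel_of_boxRelevant hπ β _ hL.2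
    refine ⟨fun x y => hπ.filtRel_of_rel fun χ hχ => ?_, fun x y h hb => ?_⟩
    · rw [mem_iff_of_isAxiom (.box_choice α β χ), mem_conj]
      exact ⟨mem_box.2 fun z hz => (hχ z).2 (.inl (h₁.1 x z hz)),
        mem_box.2 fun z hz => (hχ z).2 (.inr (h₂.1 x z hz))⟩
    · rw [mem_iff_of_isAxiom (.box_choice α β ψ), mem_conj] at hb
      exact h.elim (fun h => h₁.2 x y h hb.1) (fun h => h₂.2 x y h hb.2)
  | .star α, ψ, hL => by
    simp only [Prog.boxRelevant, List.append_subset, List.cons_subset] at hL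
    have h₁ := rel_of_boxRelevant hπ α _ hL.2
    refine ⟨fun x y => hπ.filtRel_of_rel fun χ hχ => ?_, fun x y h hb => ?_⟩
    · refine mp (mem_of_isAxiom (.box_ind α χ)) (mem_conj.2 ⟨(hχ x).2 .refl, ?_⟩)
      exact mem_box.2 fun z _ => mem_imp.2 fun hz => mem_box.2 fun t ht =>
        (hχ t).2 (.tail ((hχ z).1 hz) (h₁.1 z t ht))
    · -- `[α*]ψ` itself is propagated along `α`-steps.
      have key : ∀ t, filtRel π (.star α) (π x) t → ∀ z, π z = t → Form.box (.star α) ψ ∈ z := by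
        intro t ht
        induction ht with
        | refl => exact fun z hz => ((hπ.eq_iff z x).1 hz _ hL.1.1).2 hb
        | @tail s _ _ hst ih =>
          rintro z rfl
          obtain ⟨s, rfl⟩ := hπ.surjective s
          refine h₁.2 s z hst ?_
          exact (mem_conj.1 ((mem_iff_of_isAxiom (.box_star α ψ)).1 (ih s rfl))).2
      exact (mem_conj.1 ((mem_iff_of_isAxiom (.box_star α ψ)).1 (key _ h y rfl))).1
  | .test φ, ψ, hL => by
    simp only [Prog.boxRelevant, List.append_subset, List.cons_subset] at hL
    have ih := mem_iff_of_relevant hπ φ hL.2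
    refine ⟨fun x y => hπ.filtRel_of_rel fun χ hχ => ?_, fun x y h hb => ?_⟩
    · rw [mem_iff_of_isAxiom (.box_test φ χ), mem_imp]
      exact fun h => (hχ x).2 ⟨rfl, (ih x).1.1 h⟩
    · rw [mem_iff_of_isAxiom (.box_test φ ψ), mem_imp] at hb
      exact ((hπ.eq_iff x y).1 h.1 _ hL.1.1).1 (hb ((ih x).1.2 h.2))
termination_by structural α => α
end

end Filtration

theorem Provable.of_valid {φ : Form AF AP} (h : Valid.{u, v, w} φ) : Provable φ := by
  by_contra hφ
  obtain ⟨x, -, hx⟩ := exists_MCS_of_not_deriv (mt Deriv.provable hφ)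
  obtain ⟨T, π, hπ⟩ := exists_isFiltration.{u, v, w} φ.relevant
  have : Nonempty T := ⟨π x⟩
  refine hx (((mem_iff_of_relevant hπ φ (List.Subset.refl _) x).1).2 ?_)
  rw [filtPos, ← (stdModel_pos_neg _ _ _ φ).1]
  exact h T _ (stdModel_isStandard _ _ _) (π x)

end BPDL

theorem mainTheorem1 {AF : Type u} {AP : Type v} [Countable AF] [Countable AP]
    (φ : BPDL.Form AF AP) :
    BPDL.Provable φ ↔ BPDL.Valid.{u, v, w} φ :=
  ⟨fun h _ _ hM => h.pos hM, .of_valid⟩
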